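/- Let $p$ be a prime, $q=p^h$ with $h\ge 1$, and $m\ge 2$. For an $\mathbb F_p$-subspace $W$ of $\mathbb F_q^{m+1}$ let $L_W$ denote the set of points of $\mathrm{PG}(m,q)$ (the projective space of $\mathbb F_q^{m+1}$) defined by the nonzero vectors of $W$. Let $f\colon \mathbb F_q^{m-1}\to\mathbb F_q$ be an $\mathbb F_p$-linear map (that is, an additive map in the $m-1$ variables $x_0,\dots,x_{m-2}$), and put $$U=\{(x_0,\dots,x_{m-2},f(x_0,\dots,x_{m-2}),y): x_0,\dots,x_{m-2}\in\mathbb F_q,\ y\in\mathbb F_p\},$$ $$W=\{(x_0,\dots,x_{m-2},y,0): x_0,\dots,x_{m-2}\in\mathbb F_q,\ y\in\mathbb F_p\}.$$ Let $\mathcal M$ be the multiset of points on the symmetric difference $L_U\mathbin{\triangle} L_W$ in which the points of $L_U\setminus L_W$ have multiplicity $1$ and the points of $L_W\setminus L_U$ have multiplicity $p-1$, and let $|\mathcal M|$ be the sum of all multiplicities. Then $L_U\mathbin{\triangle} L_W$ is non-empty, and: (1) There is a hyperplane of $\mathrm{PG}(m,q)$ disjoint from $\mathcal M$. (2) $|\mathcal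 M|=(p-1)(q^{m-1}+q^{m-2})+q^{m-2}$ if and only if $$|L_U\cap L_W|=q^{m-2}\,\frac{q-1}{p-1}+\frac{q^{m-2}-1}{q-1}.$$ (3) Call a polynomial $P(X)=\sum_{i=0}^{r-1}a_iX^{p^i}\in\mathbb F_q[X]$ scattered if $|\{P(x)/x: x\in\mathbb F_q^*\}|=\frac{q-1}{p-1}$. Scattered polynomials exist for every $q=p^h$. If $f(x_0,\dots,x_{m-2})=P(x_0)$ with $P$ scattered, then $|L_U\cap L_W|=q^{m-2}\frac{q-1}{p-1}+\frac{q^{m-2}-1}{q-1}$, and, after deleting a suitable hyperplane disjoint from $\mathcal M$ and identifying its complement with $\mathrm{AG}(m,q)$, $\mathcal M$ is a multiset of points of $\mathrm{AG}(m,q)$ that has a point of multiplicity $1$, meets every affine line in $0 \bmod p$ points (counted with multiplicity), and has size exactly $(p-1)(q^{m-1}+q^{m-2})+q^{m-2}$. Hence the lower bound $(p-1)(q^{m-1}+q^{m-2})+q^{m-2}$ for the size of such affine multisets is attained for all $q=p^h$ and $m\ge2$. -/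

import Mathlib

open scoped LinearAlgebra.Projectivization

namespace AffineMultisets

section LinearSets

variable {K F V : Type*} [Field K] [Field F] [Algebra K F] [AddCommGroup V] [Module F V]
  [Module K V]

/-- The linear set `L_W`: the points of the projective space of the `F`-vector space `V` that are
defined by the nonzero vectors of the `K`-subspace `W` of `V`. -/
def linearSet (F : Type*) [Field F] [Algebra K F] [Module F V] (W : Submodule K V) :
    Set (ℙ F V) :=
  {Q | ∃ w ∈ W, ∃ hw : w ≠ 0, Q = Projectivization.mk F w hw}

end LinearSets

section Multisets

variable {X : Type*}

/-- A multiset of points of a finite geometry is given by its multiplicity function (which is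
zero outside its support). `multiplicitySum μ T` is the number of points of the multiset in `T`,
counted with multiplicity. -/
noncomputable def multiplicitySum (μ : X → ℕ) (T : Set X) : ℕ := ∑ᶠ x ∈ T, μ x

/-- The size of a multiset of points: the sum of all multiplicities. -/
noncomputable def multisetSize (μ : X → ℕ) : ℕ := ∑ᶠ x, μ x

open Classical in
/-- The multiset on the symmetric difference of `A` and `B` in which the points of `A \ B` have
multiplicity `t` and the points of `B \ A` have multiplicity `p - t`. -/
noncomputable def symmDiffMultiset (p t : ℕ) (A B : Set X) : X → ℕ := fun x =>
  if x ∈ A \ B then t else if x ∈ B \ A then p - t else 0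

end Multisets

section Construction

variable {F : Type*} [Field F]

/-- The vector `(x_0, …, x_{m-2}, a, b)` of `F^{m+1}` (for `m ≥ 1`). -/
def vec (m : ℕ) (x : Fin (m - 1) → F) (a b : F) : Fin (m + 1) → F := fun i =>
  if h : i.val < m - 1 then x ⟨i.val, h⟩ else if i.val = m - 1 then a else b

theorem vec_add (m : ℕ) (x x' : Fin (m - 1) → F) (a a' b b' : F) :
    vec m x a b + vec m x' a' b' = vec m (x + x') (a + a') (b + b') := by
  ext i
  simp only [vec, Pi.add_apply]
  split_ifs <;> rfl

theorem vec_smul (p : ℕ) [Fact p.Prime] [Algebra (ZMod p) F] (m : ℕ) (c : ZMod p)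
    (x : Fin (m - 1) → F) (a b : F) :
    c • vec m x a b = vec m (c • x) (c • a) (c • b) := by
  ext i
  simp only [vec, Pi.smul_apply]
  split_ifs <;> rfl

theorem vec_zero (m : ℕ) : vec m (0 : Fin (m - 1) → F) 0 0 = 0 := by
  ext i
  simp [vec]

variable (p : ℕ) [Fact p.Prime] [Algebra (ZMod p) F]

/-- The `𝔽_p`-subspace
`U = {(x_0, …, x_{m-2}, f(x_0, …, x_{m-2}), y) : x_i ∈ F, y ∈ 𝔽_p}` of `F^{m+1}`. -/
def spaceU (m : ℕ) (f : (Fin (m - 1) → F) →ₗ[ZMod p] F) :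
    Submodule (ZMod p) (Fin (m + 1) → F) where
  carrier := {v | ∃ (x : Fin (m - 1) → F) (y : ZMod p),
    v = vec m x (f x) (algebraMap (ZMod p) F y)}
  zero_mem' := ⟨0, 0, by simp [vec_zero]⟩
  add_mem' := by
    rintro _ _ ⟨x, y, rfl⟩ ⟨x', y', rfl⟩
    exact ⟨x + x', y + y', by rw [vec_add, map_add, map_add]⟩
  smul_mem' := by
    rintro c _ ⟨x, y, rfl⟩
    exact ⟨c • x, c * y, by rw [vec_smul, map_smul, map_mul, Algebra.smul_def c (algebraMap _ F y)]⟩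

/-- The `𝔽_p`-subspace `W = {(x_0, …, x_{m-2}, y, 0) : x_i ∈ F, y ∈ 𝔽_p}` of `F^{m+1}`. -/
def spaceW (F : Type*) [Field F] [Algebra (ZMod p) F] (m : ℕ) :
    Submodule (ZMod p) (Fin (m + 1) → F) where
  carrier := {v | ∃ (x : Fin (m - 1) → F) (y : ZMod p),
    v = vec m x (algebraMap (ZMod p) F y) 0}
  zero_mem' := ⟨0, 0, by simp [vec_zero]⟩
  add_mem' := by
    rintro _ _ ⟨x, y, rfl⟩ ⟨x', y', rfl⟩
    exact ⟨x + x', y + y', by rw [vec_add, map_add, add_zero]⟩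
  smul_mem' := by
    rintro c _ ⟨x, y, rfl⟩
    exact ⟨c • x, c * y, by
      rw [vec_smul, map_mul, Algebra.smul_def c (algebraMap _ F y), smul_zero]⟩

end Construction

section Scattered

variable {F : Type*} [Field F]

/-- `P` is an `𝔽_p`-linearized polynomial: `P = ∑_{i < r} a_i X^{p^i}`. -/
def IsLinearized (p : ℕ) (P : Polynomial F) : Prop :=
  ∃ (r : ℕ) (a : ℕ → F),
    P = ∑ i ∈ Finset.range r, Polynomial.C (a i) * Polynomial.X ^ (p ^ i)

/-- `P` is a scattered `𝔽_p`-linearized polynomial over the finite field `F` of order `q`: it is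
linearized and `|{P(x)/x : x ∈ F, x ≠ 0}| = (q - 1)/(p - 1)`. -/
def IsScattered (p : ℕ) (P : Polynomial F) : Prop :=
  IsLinearized p P ∧
    ({z : F | ∃ x : F, x ≠ 0 ∧ z = P.eval x / x}.ncard : ℚ) =
      ((Nat.card F : ℚ) - 1) / ((p : ℚ) - 1)

theorem IsLinearized.eval_add {p : ℕ} [Fact p.Prime] [Algebra (ZMod p) F] {P : Polynomial F}
    (hP : IsLinearized p P) (x y : F) : P.eval (x + y) = P.eval x + P.eval y := by
  have : CharP F p := charP_of_injective_algebraMap (algebraMap (ZMod p) F).injective p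
  obtain ⟨r, a, rfl⟩ := hP
  simp only [Polynomial.eval_finsetSum, Polynomial.eval_mul, Polynomial.eval_C,
    Polynomial.eval_pow, Polynomial.eval_X, ← Finset.sum_add_distrib]
  exact Finset.sum_congr rfl fun i _ => by rw [add_pow_char_pow, mul_add]

/-- The `𝔽_p`-linear map `x ↦ P(x)` of an `𝔽_p`-linearized polynomial `P`. -/
def linearizedMap (p : ℕ) [Fact p.Prime] [Algebra (ZMod p) F] (P : Polynomial F)
    (hP : IsLinearized p P) : F →ₗ[ZMod p] F :=
  AddMonoidHom.toZModLinearMap p (AddMonoidHom.mk' (fun x => P.eval x) hP.eval_add)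

end Scattered

section Affine

variable {F : Type*} [Field F]

theorem snoc_one_ne_zero {m : ℕ} (x : Fin m → F) :
    (Fin.snoc (α := fun _ => F) x 1 : Fin (m + 1) → F) ≠ 0 := fun h => by
  have := congrFun h (Fin.last m)
  simp at this

/-- The embedding of the affine space `AG(m, F) = F^m` into `PG(m, F)` as the complement of a
hyperplane, `x ↦ ⟨g(x_0, …, x_{m-1}, 1)⟩`, where the linear automorphism `g` of `F^{m+1}` is the
choice of coordinates. The missing hyperplane is the image under `g` of that with equation
`X_m = 0`. -/
def affineChart {m : ℕ} (g : (Fin (m + 1) → F) ≃ₗ[F] (Fin (m + 1) → F)) (x : Fin m → F) :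
    ℙ F (Fin (m + 1) → F) :=
  Projectivization.mk F (g (Fin.snoc (α := fun _ => F) x 1))
    ((map_ne_zero_iff g g.injective).2 (snoc_one_ne_zero x))

/-- A multiset of points of `AG(m, F)` is a `(0 mod p)`-multiset if it meets every affine line in
`0 mod p` points, counted with multiplicity. -/
def IsAffineZeroMod {m : ℕ} (p : ℕ) (ν : (Fin m → F) → ℕ) : Prop :=
  ∀ l : AffineSubspace F (Fin m → F), Module.finrank F l.direction = 1 →
    p ∣ multiplicitySum ν (l : Set (Fin m → F))

end Affine

end AffineMultisets

open AffineMultisets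

/-! Modulo `p`, the multiplicities of the multiset are the indicator of `L_U` minus the indicator of
`L_W`. A nonzero `𝔽_p`-subspace has `1 mod p` points in its linear set
(`ncard_linearSet_cast_eq_one`), so an `F`-subspace meeting both `U` and `W` nontrivially has weight
`1 - 1 = 0`. Both `U` and `W` have order `q^(m-1) * p`, which forces them to meet every subspace of
order at least `q^2`, in particular every line (`isAffineZeroMod_comp_affineChart`).

The disjoint hyperplane comes from the trace (`exists_functional_ne_zero`). Choose `a` with `Tr (f
x) = Tr (∑ a_i x_i)` and `c` with `Tr c = 1`, and take `z = ∑ a_i x_i + c b` in the coordinates `(x,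
z, b)`. Points of `L_U \ L_W` normalise to `(x, f x, 1)`, where the trace of the defining form is
`-1`. At a point `(x, z, 0)` of the hyperplane, `t ↦ f (t x) - t z` has image in the kernel of the
trace, so it has a nonzero root, which puts the point in `L_U`.

For the size, `L_U \ L_W` always has `q^(m-1)` points and `L_W` is the full hyperplane `b = 0`, so
the size is an affine function of `|L_U ∩ L_W|`. When `f` depends on one coordinate, that
intersection is counted through the values `f(x)/x` (`ncard_linearSet_inter_of_proj`); `X^p` is
scattered because `x^(p-1)` takes `(q-1)/(p-1)` nonzero values. -/

namespace AffineMultisets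

/-! ### Linear sets over a general field extension. -/

section LinearSets

variable {K F V : Type*} [Field K] [Field F] [Algebra K F] [AddCommGroup V] [Module F V]
  [Module K V]

theorem mk_mem_linearSet_iff {W : Submodule K V} {v : V} (hv : v ≠ 0) :
    Projectivization.mk F v hv ∈ linearSet F W ↔ ∃ c : F, c ≠ 0 ∧ c • v ∈ W := by
  constructor
  · rintro ⟨w, hw, hw0, h⟩
    obtain ⟨c, hc⟩ := (Projectivization.mk_eq_mk_iff' F w v hw0 hv).1 h.symm
    refine ⟨c, ?_, hc ▸ hw⟩
    rintro rfl
    exact hw0 (by rw [← hc, zero_smul])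
  · rintro ⟨c, hc, hcv⟩
    exact ⟨c • v, hcv, smul_ne_zero hc hv,
      ((Projectivization.mk_eq_mk_iff' F (c • v) v (smul_ne_zero hc hv) hv).2 ⟨c, rfl⟩).symm⟩

/-- Holds because `T` is closed under `F`-scaling. It lets the global count of points of a linear
set be applied inside a single subspace. -/
theorem linearSet_inf_restrictScalars [IsScalarTower K F V] (W : Submodule K V)
    (T : Submodule F V) :
    linearSet F (W ⊓ T.restrictScalars K) = linearSet F W ∩ T.projectivization := by
  ext Q
  induction Q using Projectivization.ind with
  | h v hv =>
    rw [Set.mem_inter_iff, mk_mem_linearSet_iff, mk_mem_linearSet_iff, SetLike.mem_coe,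
      Submodule.mk_mem_projectivization_iff]
    simp only [Submodule.mem_inf, Submodule.restrictScalars_mem]
    constructor
    · rintro ⟨c, hc, h1, h2⟩
      exact ⟨⟨c, hc, h1⟩, (T.smul_mem_iff hc).1 h2⟩
    · rintro ⟨⟨c, hc, h1⟩, h2⟩
      exact ⟨c, hc, h1, T.smul_mem c h2⟩

/-- Subspaces whose orders multiply to more than the order of the whole space meet
nontrivially. -/
theorem inf_ne_bot_of_card_lt [Finite V] (A B : Submodule K V)
    (h : Nat.card V < Nat.card A * Nat.card B) : A ⊓ B ≠ ⊥ := by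
  intro hAB
  -- A trivial intersection would make the addition map `A × B → V` injective.
  have hinj : Function.Injective (fun z : A × B => (z.1 : V) + z.2) := by
    rintro ⟨a, b⟩ ⟨a', b'⟩ hz
    have hz' : (a : V) - a' = b' - b := by
      rw [sub_eq_sub_iff_add_eq_add, add_comm (b' : V)]
      exact hz
    have hmem : (a : V) - a' ∈ A ⊓ B :=
      ⟨A.sub_mem a.2 a'.2, hz' ▸ B.sub_mem b'.2 b.2⟩
    rw [hAB, Submodule.mem_bot] at hmem
    rw [hmem] at hz'
    exact Prod.ext (Subtype.ext (sub_eq_zero.1 hmem)) (Subtype.ext (sub_eq_zero.1 hz'.symm).symm)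
  have := Nat.card_le_card_of_injective _ hinj
  rw [Nat.card_prod] at this
  omega

end LinearSets

/-! ### Congruences modulo `p` for linear sets. -/

section Congruence

variable {p : ℕ} [Fact p.Prime] {F V : Type*} [Field F] [Algebra (ZMod p) F] [AddCommGroup V]
  [Module F V] [Module (ZMod p) V]

theorem natCard_submodule_cast_eq_zero [Finite V] {W : Submodule (ZMod p) V} (hW : W ≠ ⊥) :
    (Nat.card W : ZMod p) = 0 := by
  have : Nontrivial W := Submodule.nontrivial_iff_ne_bot.2 hW
  have : Module.Finite (ZMod p) W := Module.Finite.of_finite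
  rw [Module.natCard_eq_pow_finrank (K := ZMod p), Nat.card_zmod, Nat.cast_pow, CharP.cast_eq_zero,
    zero_pow Module.finrank_pos.ne']

/-- A nonempty `𝔽_p`-linear set has `1 mod p` points. -/
theorem ncard_linearSet_cast_eq_one [Finite V] [IsScalarTower (ZMod p) F V]
    {W : Submodule (ZMod p) V} (hW : W ≠ ⊥) : ((linearSet F W).ncard : ZMod p) = 1 := by
  classical
  have := Fintype.ofFinite V
  have : Finite (ℙ F V) := Quotient.finite _
  have := Fintype.ofFinite (ℙ F V)
  let s : Finset {v : V // v ≠ 0} := Finset.univ.filter fun v => v.1 ∈ W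
  let t : Finset (ℙ F V) := (linearSet F W).toFinset
  have hst : ∀ v ∈ s, Projectivization.mk' F v ∈ t := by
    intro v hv
    simp only [s, Finset.mem_filter, Finset.mem_univ, true_and] at hv
    rw [Set.mem_toFinset]
    exact ⟨v, hv, v.2, rfl⟩
  -- Used twice: for the nonzero vectors of `W`, and for those of `W ∩ ⟨w⟩`, the fibre over a point.
  -- Summing `-1` over the points then gives `-|L_W| = -1`.
  have key (W' : Submodule (ZMod p) V) (hW' : W' ≠ ⊥) (u : Finset {v : V // v ≠ 0})
      (hu : ∀ v, v ∈ u ↔ v.1 ∈ W') : (u.card : ZMod p) = -1 := by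
    have h1 := natCard_submodule_cast_eq_zero hW'
    have h2 : Nat.card W' = u.card + 1 := by
      have h3 : (Finset.univ.filter fun v => v ∈ W') =
          insert 0 (u.map (Function.Embedding.subtype _)) := by
        ext v
        by_cases hv : v = 0
        · simp [hv]
        · simp [hv, hu]
      rw [Nat.card_eq_fintype_card, Fintype.card_subtype, h3, Finset.card_insert_of_notMem,
        Finset.card_map]
      simp
    rw [h2, Nat.cast_add, Nat.cast_one] at h1
    exact eq_neg_of_add_eq_zero_left h1
  have hcard := Finset.card_eq_sum_card_fiberwise hst
  have hs : (s.card : ZMod p) = -1 := key W hW s (by simp [s])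
  rw [hcard, Nat.cast_sum, Finset.sum_congr rfl (g := fun _ => (-1 : ZMod p)), Finset.sum_const,
    nsmul_eq_mul, mul_neg_one, neg_inj] at hs
  · rw [Set.ncard_eq_toFinset_card', hs]
  · intro Q hQ
    rw [Set.mem_toFinset] at hQ
    obtain ⟨w, hw, hw0, rfl⟩ := hQ
    refine key (W ⊓ (F ∙ w).restrictScalars (ZMod p)) ?_ _ fun v => ?_
    · intro h
      have : w ∈ W ⊓ (F ∙ w).restrictScalars (ZMod p) := ⟨hw, Submodule.mem_span_singleton_self w⟩
      rw [h] at this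
      exact hw0 this
    · simp only [s, Finset.mem_filter, Finset.mem_univ, true_and, Submodule.mem_inf,
        Submodule.restrictScalars_mem, Submodule.mem_span_singleton, Projectivization.mk'_eq_mk,
        Projectivization.mk_eq_mk_iff']

/-- The multiset on the symmetric difference of two `𝔽_p`-linear sets meets every subspace that
has points of both in `0 mod p` points. -/
theorem dvd_multiplicitySum_symmDiffMultiset [Finite V] [IsScalarTower (ZMod p) F V]
    {A B : Submodule (ZMod p) V} {T : Submodule F V} (hA : A ⊓ T.restrictScalars (ZMod p) ≠ ⊥)
    (hB : B ⊓ T.restrictScalars (ZMod p) ≠ ⊥) :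
    p ∣ multiplicitySum (symmDiffMultiset p 1 (linearSet F A) (linearSet F B))
      (T.projectivization : Set (ℙ F V)) := by
  classical
  have : Finite (ℙ F V) := Quotient.finite _
  have := Fintype.ofFinite (ℙ F V)
  have hp : 1 ≤ p := (Fact.out : p.Prime).one_le
  have h1 := ncard_linearSet_cast_eq_one (F := F) hA
  have h2 := ncard_linearSet_cast_eq_one (F := F) hB
  rw [linearSet_inf_restrictScalars, Set.ncard_eq_toFinset_card'] at h1 h2
  -- The target `0` is written as `1 - 1 = |L_A ∩ T| - |L_B ∩ T|`, after which both sides are sums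
  -- over `T` that agree term by term, as `p - 1 = -1` in `ZMod p`.
  rw [← CharP.cast_eq_zero_iff (ZMod p) p, multiplicitySum, finsum_mem_eq_toFinset_sum,
    Nat.cast_sum, ← sub_self (1 : ZMod p)]
  nth_rewrite 1 [← h1]
  rw [← h2, Set.toFinset_inter, Set.toFinset_inter, Finset.inter_comm (linearSet F A).toFinset,
    Finset.inter_comm (linearSet F B).toFinset, ← Finset.filter_mem_eq_inter, ← Finset.filter_mem_eq_inter,
    Finset.card_filter, Finset.card_filter, Nat.cast_sum, Nat.cast_sum, ← Finset.sum_sub_distrib]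
  refine Finset.sum_congr rfl fun Q _ => ?_
  by_cases hQA : Q ∈ linearSet F A <;> by_cases hQB : Q ∈ linearSet F B <;>
    simp [symmDiffMultiset, hQA, hQB, Nat.cast_sub hp]

theorem multisetSize_symmDiffMultiset {X : Type*} [Finite X] (p : ℕ) (A B : Set X) :
    multisetSize (symmDiffMultiset p 1 A B) = (A \ B).ncard + (p - 1) * (B \ A).ncard := by
  classical
  have := Fintype.ofFinite X
  have h (S : Set X) : S.ncard = (Finset.univ.filter (· ∈ S)).card := by
    rw [Set.ncard_eq_toFinset_card']
    congr 1
    ext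
    simp
  rw [multisetSize, finsum_eq_sum_of_fintype, h, h, Finset.card_filter, Finset.card_filter, Finset.mul_sum,
    ← Finset.sum_add_distrib]
  refine Finset.sum_congr rfl fun Q _ => ?_
  by_cases hQA : Q ∈ A <;> by_cases hQB : Q ∈ B <;> simp [symmDiffMultiset, hQA, hQB]

end Congruence

/-! ### Affine charts and projective closures of affine lines. -/

section Chart

variable {F : Type*} [Field F] {m : ℕ}

/-- The complement of the kernel of a nonzero functional `φ` is an affine chart. -/
theorem exists_equiv_apply_eq_last (φ : (Fin (m + 1) → F) →ₗ[F] F) (hφ : φ ≠ 0) :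
    ∃ g : (Fin (m + 1) → F) ≃ₗ[F] (Fin (m + 1) → F), ∀ v, φ (g v) = v (Fin.last m) := by
  obtain ⟨v₀, hv₀⟩ : ∃ v, φ v = 1 := (LinearMap.surjective hφ) 1
  have hrank : Module.finrank F (LinearMap.ker φ) = m := by
    have := Module.Dual.finrank_ker_add_one_of_ne_zero (f := φ) hφ
    simpa using this
  let e : (Fin m → F) ≃ₗ[F] LinearMap.ker φ := LinearEquiv.ofFinrankEq _ _ (by simp [hrank])
  -- The first `m` coordinates parametrise `ker φ`; the last one multiplies a vector on which `φ` is
  -- `1`.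
  let G : (Fin (m + 1) → F) →ₗ[F] (Fin (m + 1) → F) :=
    (LinearMap.ker φ).subtype ∘ₗ e.toLinearMap ∘ₗ LinearMap.funLeft F F Fin.castSucc +
      (LinearMap.proj (Fin.last m)).smulRight v₀
  have hG (v) : φ (G v) = v (Fin.last m) := by simp [G, hv₀]
  refine ⟨LinearEquiv.ofInjectiveEndo G ?_, fun v => hG v⟩
  rw [← LinearMap.ker_eq_bot, LinearMap.ker_eq_bot']
  intro v hv
  have h0 : v (Fin.last m) = 0 := by rw [← hG v, hv, map_zero]
  have h1 : LinearMap.funLeft F F (Fin.castSucc (n := m)) v = 0 := by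
    simpa [G, h0] using hv
  ext i
  induction i using Fin.lastCases with
  | last => exact h0
  | cast i => exact congrFun h1 i

variable (g : (Fin (m + 1) → F) ≃ₗ[F] (Fin (m + 1) → F))

theorem affineChart_injective : Function.Injective (affineChart g) := by
  intro x y hxy
  obtain ⟨c, hc⟩ := (Projectivization.mk_eq_mk_iff' ..).1 hxy
  rw [← map_smul] at hc
  have hc' := g.injective hc
  have h1 : c = 1 := by simpa using congrFun hc' (Fin.last m)
  subst h1
  ext i
  simpa using (congrFun hc' i.castSucc).symm

theorem mk_mem_range_affineChart {v : Fin (m + 1) → F} (hv : v ≠ 0)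
    (h : g.symm v (Fin.last m) ≠ 0) : Projectivization.mk F v hv ∈ Set.range (affineChart g) := by
  set c := g.symm v (Fin.last m) with hc
  refine ⟨fun i => c⁻¹ * g.symm v i.castSucc, ?_⟩
  refine (Projectivization.mk_eq_mk_iff' ..).2 ⟨c⁻¹, ?_⟩
  rw [← g.apply_symm_apply v, ← map_smul, g.apply_symm_apply]
  congr 1
  ext i
  induction i using Fin.lastCases with
  | last => simp [← hc, h]
  | cast i => simp

theorem multisetSize_comp_affineChart {μ : ℙ F (Fin (m + 1) → F) → ℕ}
    (hμ : Function.support μ ⊆ Set.range (affineChart g)) :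
    multisetSize (μ ∘ affineChart g) = multisetSize μ := by
  rw [multisetSize, multisetSize, ← finsum_mem_univ μ, ← finsum_mem_inter_support,
    Set.univ_inter, ← Set.inter_eq_self_of_subset_right hμ, finsum_mem_inter_support,
    finsum_mem_range (affineChart_injective g)]
  rfl

/-- The linear subspace of `F^{m+1}` defining the projective closure of an affine line. -/
theorem exists_multiplicitySum_comp_affineChart_eq [Finite F] {μ : ℙ F (Fin (m + 1) → F) → ℕ}
    (hμ : Function.support μ ⊆ Set.range (affineChart g)) (l : AffineSubspace F (Fin m → F))
    (hl : Module.finrank F l.direction = 1) :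
    ∃ T : Submodule F (Fin (m + 1) → F), Nat.card F ^ 2 ≤ Nat.card T ∧
      multiplicitySum (μ ∘ affineChart g) l =
        multiplicitySum μ (T.projectivization : Set (ℙ F (Fin (m + 1) → F))) := by
  obtain ⟨x₀, hx₀⟩ : (l : Set (Fin m → F)).Nonempty := by
    rw [AffineSubspace.nonempty_iff_ne_bot]
    rintro rfl
    rw [AffineSubspace.direction_bot, finrank_bot] at hl
    exact zero_ne_one hl
  -- `ψ (x, t) = x - t x₀` homogenises `x - x₀`, so membership in the line becomes `ψ ∈
  -- l.direction`.
  let ψ : (Fin (m + 1) → F) →ₗ[F] (Fin m → F) :=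
    LinearMap.funLeft F F Fin.castSucc - (LinearMap.proj (Fin.last m)).smulRight x₀
  let T := l.direction.comap (ψ ∘ₗ g.symm.toLinearMap)
  have hψ (x : Fin m → F) (t : F) : ψ (Fin.snoc (α := fun _ => F) (x + t • x₀) t) = x := by
    ext i
    simp [ψ, LinearMap.funLeft_apply]
  have hT (x : Fin m → F) : affineChart g x ∈ T.projectivization ↔ x ∈ l := by
    rw [affineChart, Submodule.mk_mem_projectivization_iff]
    have := hψ (x - x₀) 1
    rw [one_smul, sub_add_cancel] at this
    simp only [T, Submodule.mem_comap, LinearMap.comp_apply, LinearEquiv.coe_coe,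
      LinearEquiv.symm_apply_apply]
    rw [this, ← vsub_eq_sub, AffineSubspace.vsub_right_mem_direction_iff_mem hx₀]
  refine ⟨T, ?_, ?_⟩
  · have hD : Nat.card l.direction = Nat.card F := by
      rw [Module.natCard_eq_pow_finrank (K := F), hl, pow_one]
    rw [sq]
    nth_rewrite 1 [← hD]
    rw [← Nat.card_prod]
    refine Nat.card_le_card_of_injective (fun z : l.direction × F =>
      (⟨g (Fin.snoc (α := fun _ => F) (z.1.1 + z.2 • x₀) z.2), by simp [T, hψ]⟩ : T)) ?_
    rintro ⟨d, t⟩ ⟨d', t'⟩ h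
    have h' := g.injective (congrArg Subtype.val h)
    have ht : t = t' := by simpa using congrFun h' (Fin.last m)
    have hd := congrArg ψ h'
    exact Prod.ext (Subtype.ext (((hψ d t).symm.trans hd).trans (hψ d' t'))) ht
  · rw [multiplicitySum, multiplicitySum, ← finsum_mem_inter_support μ]
    have : (T.projectivization : Set (ℙ F (Fin (m + 1) → F))) ∩ Function.support μ =
        affineChart g '' l ∩ Function.support μ := by
      ext Q
      simp only [Set.mem_inter_iff, SetLike.mem_coe, Set.mem_image]
      refine and_congr_left fun hQ => ?_
      obtain ⟨x, rfl⟩ := hμ hQ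
      rw [hT]
      simp [(affineChart_injective g).eq_iff]
    rw [this, finsum_mem_inter_support, finsum_mem_image (affineChart_injective g).injOn]
    rfl

end Chart

end AffineMultisets

namespace AffineMultisets

/-! ### Coordinates of `F^(m+1)` and point counts of subspaces. -/

section Vec

variable {F : Type*} {m : ℕ}

theorem vec_coord (x : Fin (m - 1) → F) (a b : F) (i : Fin (m - 1)) :
    vec m x a b ⟨i, by omega⟩ = x i := by
  simp [vec]

theorem vec_penultimate (x : Fin (m - 1) → F) (a b : F) :
    vec m x a b ⟨m - 1, by omega⟩ = a := by
  simp [vec]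

theorem vec_last (hm : 1 ≤ m) (x : Fin (m - 1) → F) (a b : F) :
    vec m x a b (Fin.last m) = b := by
  have h1 : ¬ m < m - 1 := by omega
  have h2 : m ≠ m - 1 := by omega
  simp [vec, h1, h2]

theorem exists_eq_vec (hm : 1 ≤ m) (v : Fin (m + 1) → F) : ∃ x a b, v = vec m x a b := by
  refine ⟨fun i => v ⟨i, by omega⟩, v ⟨m - 1, by omega⟩, v (Fin.last m), ?_⟩
  ext i
  simp only [vec]
  split_ifs with h1 h2
  · rfl
  · congr 1
    exact Fin.ext h2
  · congr 1
    refine Fin.ext ?_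
    simp only [Fin.val_last]
    omega

theorem vec_inj (hm : 1 ≤ m) {x x' : Fin (m - 1) → F} {a a' b b' : F} :
    vec m x a b = vec m x' a' b' ↔ x = x' ∧ a = a' ∧ b = b' := by
  refine ⟨fun h => ⟨?_, ?_, ?_⟩, by rintro ⟨rfl, rfl, rfl⟩; rfl⟩
  · ext i
    rw [← vec_coord x a b, h, vec_coord]
  · rw [← vec_penultimate x a b, h, vec_penultimate]
  · rw [← vec_last hm x a b, h, vec_last hm]

variable [Field F]

theorem smul_vec (c : F) (x : Fin (m - 1) → F) (a b : F) :
    c • vec m x a b = vec m (c • x) (c * a) (c * b) := by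
  ext i
  simp only [vec, Pi.smul_apply, smul_eq_mul]
  split_ifs <;> rfl

theorem vec_eq_zero_iff (hm : 1 ≤ m) {x : Fin (m - 1) → F} {a b : F} :
    vec m x a b = 0 ↔ x = 0 ∧ a = 0 ∧ b = 0 := by
  rw [← vec_zero, vec_inj hm]

theorem mk_vec_eq_mk_vec_iff (hm : 1 ≤ m) {x x' : Fin (m - 1) → F} {a a' b b' : F}
    (h : vec m x a b ≠ 0) (h' : vec m x' a' b' ≠ 0) :
    Projectivization.mk F _ h = Projectivization.mk F _ h' ↔
      ∃ c : F, c • x' = x ∧ c * a' = a ∧ c * b' = b := by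
  rw [Projectivization.mk_eq_mk_iff']
  simp only [smul_vec, vec_inj hm]

/-- The linear map `x ↦ (x_0, …, x_{m-2}, 0, 0)`. -/
def vecLinear (F : Type*) [Field F] (m : ℕ) : (Fin (m - 1) → F) →ₗ[F] (Fin (m + 1) → F) where
  toFun x := vec m x 0 0
  map_add' x y := by rw [vec_add, add_zero]
  map_smul' c x := by rw [RingHom.id_apply, smul_vec, mul_zero]

theorem vecLinear_injective (hm : 1 ≤ m) : Function.Injective (vecLinear F m) :=
  fun _ _ h => ((vec_inj hm).1 h).1

end Vec

theorem ncard_projectivization {F V : Type*} [Field F] [Finite F] [AddCommGroup V] [Module F V]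
    [Finite V] (T : Submodule F V) :
    (T.projectivization : Set (ℙ F V)).ncard =
      ∑ i ∈ Finset.range (Module.finrank F T), Nat.card F ^ i := by
  have hinj := Projectivization.map_injective T.subtype T.injective_subtype
  rw [← Projectivization.card_of_finrank F T rfl, ← Set.ncard_univ,
    ← Set.ncard_image_of_injective Set.univ hinj]
  congr 1
  ext Q
  rw [Set.image_univ, Set.mem_range, SetLike.mem_coe]
  constructor
  · induction Q using Projectivization.ind with
    | h v hv =>
      intro h
      rw [Submodule.mk_mem_projectivization_iff] at h
      exact ⟨Projectivization.mk F ⟨v, h⟩ (by simpa [Subtype.ext_iff] using hv), rfl⟩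
  · rintro ⟨R, rfl⟩
    induction R using Projectivization.ind with
    | h v hv => exact v.2

/-! ### The linear sets of `U` and `W`, and the hyperplane missing their symmetric difference. -/

section Construction

variable {p m : ℕ} [Fact p.Prime] {F : Type*} [Field F] [Algebra (ZMod p) F]
  {f : (Fin (m - 1) → F) →ₗ[ZMod p] F}

theorem vec_mem_spaceU_iff (hm : 1 ≤ m) {x : Fin (m - 1) → F} {a b : F} :
    vec m x a b ∈ spaceU p m f ↔ a = f x ∧ ∃ y : ZMod p, b = algebraMap (ZMod p) F y := by
  constructor
  · rintro ⟨x', y, h⟩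
    obtain ⟨rfl, rfl, rfl⟩ := (vec_inj hm).1 h
    exact ⟨rfl, y, rfl⟩
  · rintro ⟨rfl, y, rfl⟩
    exact ⟨x, y, rfl⟩

theorem vec_mem_spaceW_iff (hm : 1 ≤ m) {x : Fin (m - 1) → F} {a b : F} :
    vec m x a b ∈ spaceW p F m ↔ (∃ y : ZMod p, a = algebraMap (ZMod p) F y) ∧ b = 0 := by
  constructor
  · rintro ⟨x', y, h⟩
    obtain ⟨rfl, rfl, rfl⟩ := (vec_inj hm).1 h
    exact ⟨⟨y, rfl⟩, rfl⟩
  · rintro ⟨⟨y, rfl⟩, rfl⟩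
    exact ⟨x, y, rfl⟩

/-- Since the `x`-part of `W` is unrestricted, rescaling by `a⁻¹` brings any `a ≠ 0` into `𝔽_p`;
thus `L_W` fills a hyperplane. -/
theorem mk_vec_mem_linearSet_spaceW_iff (hm : 1 ≤ m) {x : Fin (m - 1) → F} {a b : F}
    (h : vec m x a b ≠ 0) :
    Projectivization.mk F _ h ∈ linearSet F (spaceW p F m) ↔ b = 0 := by
  simp only [mk_mem_linearSet_iff, smul_vec, vec_mem_spaceW_iff hm]
  constructor
  · rintro ⟨c, hc, -, hcb⟩
    exact (mul_eq_zero.1 hcb).resolve_left hc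
  · rintro rfl
    by_cases ha : a = 0
    · exact ⟨1, one_ne_zero, ⟨0, by simp [ha]⟩, mul_zero _⟩
    · exact ⟨a⁻¹, inv_ne_zero ha, ⟨1, by simp [ha]⟩, mul_zero _⟩

theorem mk_vec_mem_linearSet_spaceU_iff (hm : 1 ≤ m) {x : Fin (m - 1) → F} {a b : F}
    (h : vec m x a b ≠ 0) :
    Projectivization.mk F _ h ∈ linearSet F (spaceU p m f) ↔
      ∃ c : F, c ≠ 0 ∧ c * a = f (c • x) ∧ ∃ y : ZMod p, c * b = algebraMap (ZMod p) F y := by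
  simp only [mk_mem_linearSet_iff, smul_vec, vec_mem_spaceU_iff hm]

theorem vec_one_ne_zero (hm : 1 ≤ m) (x : Fin (m - 1) → F) (a : F) : vec m x a 1 ≠ 0 := by
  rw [Ne, vec_eq_zero_iff hm]
  exact fun h => one_ne_zero h.2.2

/-- Off `L_W` the last coordinate `y ∈ 𝔽_p` is nonzero, and dividing by it stays in `U` because `f`
is `𝔽_p`-linear. -/
theorem linearSet_spaceU_diff (hm : 1 ≤ m) :
    linearSet F (spaceU p m f) \ linearSet F (spaceW p F m) =
      Set.range fun x => Projectivization.mk F (vec m x (f x) 1) (vec_one_ne_zero hm x (f x)) := by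
  ext Q
  constructor
  · rintro ⟨⟨_, ⟨x, y, rfl⟩, hw, rfl⟩, hW⟩
    rw [mk_vec_mem_linearSet_spaceW_iff hm] at hW
    have hy : y ≠ 0 := by
      rintro rfl
      exact hW (map_zero _)
    refine ⟨y⁻¹ • x, (mk_vec_eq_mk_vec_iff hm ..).2 ⟨algebraMap (ZMod p) F y⁻¹, ?_, ?_, ?_⟩⟩
    · rw [algebraMap_smul]
    · rw [map_smul, Algebra.smul_def]
    · rw [← map_mul, inv_mul_cancel₀ hy, map_one]
  · rintro ⟨x, rfl⟩
    rw [Set.mem_sdiff, mk_vec_mem_linearSet_spaceW_iff hm, mk_vec_mem_linearSet_spaceU_iff hm]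
    exact ⟨⟨1, one_ne_zero, by simp, 1, by simp⟩, one_ne_zero⟩

theorem ncard_linearSet_spaceU_diff [Finite F] (hm : 1 ≤ m) :
    (linearSet F (spaceU p m f) \ linearSet F (spaceW p F m)).ncard = Nat.card F ^ (m - 1) := by
  rw [linearSet_spaceU_diff hm, ← Set.image_univ, Set.ncard_image_of_injective, Set.ncard_univ,
    Nat.card_fun, Nat.card_fin]
  intro x x' h
  obtain ⟨c, hx, -, hc⟩ := (mk_vec_eq_mk_vec_iff hm ..).1 h
  rw [mul_one] at hc
  rw [← hx, hc, one_smul]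

theorem linearSet_spaceW (hm : 1 ≤ m) :
    linearSet F (spaceW p F m) = (LinearMap.ker (LinearMap.proj (R := F) (φ := fun _ => F)
      (Fin.last m))).projectivization := by
  ext Q
  induction Q using Projectivization.ind with
  | h v hv =>
    obtain ⟨x, a, b, rfl⟩ := exists_eq_vec hm v
    rw [mk_vec_mem_linearSet_spaceW_iff hm, SetLike.mem_coe,
      Submodule.mk_mem_projectivization_iff, LinearMap.mem_ker, LinearMap.proj_apply, vec_last hm]

theorem finrank_ker_proj (F : Type*) [Field F] {n : ℕ} (i : Fin n) :
    Module.finrank F (LinearMap.ker (LinearMap.proj (R := F) (φ := fun _ : Fin n => F) i)) =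
      n - 1 := by
  have h : LinearMap.proj (R := F) (φ := fun _ : Fin n => F) i ≠ 0 := by
    intro h
    simpa using LinearMap.congr_fun h (fun _ => 1)
  have := Module.Dual.finrank_ker_add_one_of_ne_zero (f := LinearMap.proj (R := F)
    (φ := fun _ : Fin n => F) i) h
  rw [Module.finrank_fin_fun] at this
  omega

theorem ncard_linearSet_spaceW [Finite F] (hm : 1 ≤ m) :
    (linearSet F (spaceW p F m)).ncard = ∑ i ∈ Finset.range m, Nat.card F ^ i := by
  rw [linearSet_spaceW hm, ncard_projectivization, finrank_ker_proj, Nat.add_sub_cancel]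

theorem linearSet_inter_eq (hm : 1 ≤ m) :
    linearSet F (spaceU p m f) ∩ linearSet F (spaceW p F m) =
      {Q | ∃ (x : Fin (m - 1) → F) (h : vec m x (f x) 0 ≠ 0), Q = Projectivization.mk F _ h} := by
  ext Q
  constructor
  · rintro ⟨⟨_, ⟨x, y, rfl⟩, hw, rfl⟩, hW⟩
    rw [mk_vec_mem_linearSet_spaceW_iff hm] at hW
    simp only [hW] at hw ⊢
    exact ⟨x, hw, rfl⟩
  · rintro ⟨x, h, rfl⟩
    rw [Set.mem_inter_iff, mk_vec_mem_linearSet_spaceW_iff hm, mk_vec_mem_linearSet_spaceU_iff hm]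
    exact ⟨⟨1, one_ne_zero, by simp, 0, by simp⟩, rfl⟩

theorem card_spaceU [Finite F] (hm : 1 ≤ m) :
    Nat.card (spaceU p m f) = Nat.card F ^ (m - 1) * p := by
  have h : Nat.card ((Fin (m - 1) → F) × ZMod p) = Nat.card F ^ (m - 1) * p := by
    rw [Nat.card_prod, Nat.card_fun, Nat.card_fin, Nat.card_zmod]
  rw [← h]
  refine (Nat.card_eq_of_bijective (fun z : (Fin (m - 1) → F) × ZMod p =>
    (⟨vec m z.1 (f z.1) (algebraMap (ZMod p) F z.2), z.1, z.2, rfl⟩ : spaceU p m f)) ⟨?_, ?_⟩).symm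
  · rintro ⟨x, y⟩ ⟨x', y'⟩ h
    obtain ⟨hx, -, hy⟩ := (vec_inj hm).1 (congrArg Subtype.val h)
    exact Prod.ext hx ((algebraMap (ZMod p) F).injective hy)
  · rintro ⟨_, x, y, rfl⟩
    exact ⟨(x, y), rfl⟩

theorem card_spaceW [Finite F] (hm : 1 ≤ m) :
    Nat.card (spaceW p F m) = Nat.card F ^ (m - 1) * p := by
  have h : Nat.card ((Fin (m - 1) → F) × ZMod p) = Nat.card F ^ (m - 1) * p := by
    rw [Nat.card_prod, Nat.card_fun, Nat.card_fin, Nat.card_zmod]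
  rw [← h]
  refine (Nat.card_eq_of_bijective (fun z : (Fin (m - 1) → F) × ZMod p =>
    (⟨vec m z.1 (algebraMap (ZMod p) F z.2) 0, z.1, z.2, rfl⟩ : spaceW p F m)) ⟨?_, ?_⟩).symm
  · rintro ⟨x, y⟩ ⟨x', y'⟩ h
    obtain ⟨hx, hy, -⟩ := (vec_inj hm).1 (congrArg Subtype.val h)
    exact Prod.ext hx ((algebraMap (ZMod p) F).injective hy)
  · rintro ⟨_, x, y, rfl⟩
    exact ⟨(x, y), rfl⟩

/-- Every `𝔽_p`-linear map to `F` has the same trace as some `F`-linear functional. -/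
theorem exists_trace_eq [Finite F] {n : ℕ} (f : (Fin n → F) →ₗ[ZMod p] F) :
    ∃ a : Fin n → F, ∀ x, Algebra.trace (ZMod p) F (f x) =
      Algebra.trace (ZMod p) F (∑ i, a i * x i) := by
  have : Module.Finite (ZMod p) F := Module.Finite.of_finite
  have hB := traceForm_nondegenerate (ZMod p) F
  let ψ (i : Fin n) : Module.Dual (ZMod p) F :=
    Algebra.trace (ZMod p) F ∘ₗ f ∘ₗ LinearMap.single (ZMod p) (fun _ => F) i
  -- `a i` represents, through the nondegenerate trace form, the restriction of `Tr ∘ f` to the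
  -- `i`-th coordinate.
  refine ⟨fun i => ((Algebra.traceForm (ZMod p) F).toDual hB).symm (ψ i), fun x => ?_⟩
  rw [map_sum]
  have h (i : Fin n) : Algebra.trace (ZMod p) F
      (((Algebra.traceForm (ZMod p) F).toDual hB).symm (ψ i) * x i) = ψ i (x i) := by
    rw [← Algebra.traceForm_apply, LinearMap.BilinForm.apply_toDual_symm_apply]
  simp only [h, ψ, LinearMap.comp_apply, LinearMap.coe_single]
  rw [← map_sum, ← map_sum, Finset.univ_sum_single]

/-- A hyperplane (the kernel of `φ`) disjoint from the symmetric difference of the linear sets. -/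
theorem exists_functional_ne_zero [Finite F] (hm : 1 ≤ m)
    (f : (Fin (m - 1) → F) →ₗ[ZMod p] F) :
    ∃ φ : (Fin (m + 1) → F) →ₗ[F] F, φ ≠ 0 ∧ ∀ (v : Fin (m + 1) → F) (hv : v ≠ 0),
      Projectivization.mk F v hv ∈
        symmDiff (linearSet F (spaceU p m f)) (linearSet F (spaceW p F m)) → φ v ≠ 0 := by
  have : Module.Finite (ZMod p) F := Module.Finite.of_finite
  obtain ⟨a, ha⟩ := exists_trace_eq f
  obtain ⟨c, hc⟩ := Algebra.trace_surjective (ZMod p) F 1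
  let φ : (Fin (m + 1) → F) →ₗ[F] F := LinearMap.proj ⟨m - 1, by omega⟩ -
    ∑ i : Fin (m - 1), a i • LinearMap.proj (⟨i, by omega⟩ : Fin (m + 1)) -
    c • LinearMap.proj (Fin.last m)
  have hφ (x : Fin (m - 1) → F) (z b : F) : φ (vec m x z b) = z - ∑ i, a i * x i - c * b := by
    simp [φ, vec_last hm, vec_coord, vec_penultimate]
  refine ⟨φ, fun h => ?_, fun v hv h h0 => ?_⟩
  · have := hφ 0 1 0
    simp [h] at this
  · obtain hUW | ⟨hW, hU⟩ := h
    · change _ ∈ _ \ _ at hUW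
      rw [linearSet_spaceU_diff hm] at hUW
      obtain ⟨x, hx⟩ := hUW
      obtain ⟨d, hd⟩ := (Projectivization.mk_eq_mk_iff' ..).1 hx
      have h1 := hφ x (f x) 1
      rw [← hd, map_smul, h0, smul_zero] at h1
      have h2 := congrArg (Algebra.trace (ZMod p) F) h1
      rw [mul_one, map_sub, map_sub, ha, hc, map_zero, sub_self, zero_sub] at h2
      exact one_ne_zero (neg_eq_zero.1 h2.symm)
    · obtain ⟨x, z, b, rfl⟩ := exists_eq_vec hm v
      rw [mk_vec_mem_linearSet_spaceW_iff hm] at hW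
      subst hW
      rw [hφ, mul_zero, sub_zero, sub_eq_zero] at h0
      refine hU ((mk_vec_mem_linearSet_spaceU_iff hm hv).2 ?_)
      -- A nonzero `t` in the kernel of `G` is exactly a scalar that moves `(x, z, 0)` into `U`. All
      -- values of `G` have trace `0`, so `c` is not attained, and on a finite space failure of
      -- surjectivity yields a kernel.
      let G : F →ₗ[ZMod p] F := f ∘ₗ (LinearMap.toSpanSingleton F _ x).restrictScalars (ZMod p) -
        (LinearMap.toSpanSingleton F F z).restrictScalars (ZMod p)
      have hG (t : F) : G t = f (t • x) - t * z := by simp [G]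
      have hGt (t : F) : Algebra.trace (ZMod p) F (G t) = 0 := by
        rw [hG, h0, map_sub, ha, sub_eq_zero, Finset.mul_sum]
        congr 1
        refine Finset.sum_congr rfl fun i _ => ?_
        rw [Pi.smul_apply, smul_eq_mul, mul_left_comm]
      have hinj : ¬ Function.Injective G := by
        intro hi
        obtain ⟨t, ht⟩ := LinearMap.injective_iff_surjective.1 hi c
        have := hGt t
        rw [ht, hc] at this
        exact one_ne_zero this
      rw [← LinearMap.ker_eq_bot, LinearMap.ker_eq_bot'] at hinj
      push Not at hinj
      obtain ⟨t, ht, ht0⟩ := hinj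
      rw [hG, sub_eq_zero] at ht
      exact ⟨t, ht0, ht.symm, 0, by simp⟩

end Construction

end AffineMultisets

namespace AffineMultisets

/-! ### Intersection sizes and scattered polynomials. -/

section Scattered

variable {p m : ℕ} [Fact p.Prime] {F : Type*} [Field F] [Finite F] [Algebra (ZMod p) F]

/-- Points `(x, L (x i), 0)` with `x i ≠ 0` normalise uniquely to `x i = 1`, leaving `m - 2` free
coordinates and a value `L t / t`. Those with `x i = 0` form a projective subspace, empty when `m =
2`. -/
theorem ncard_linearSet_inter_of_proj (hm : 1 ≤ m) (L : F →ₗ[ZMod p] F) (i : Fin (m - 1)) :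
    (linearSet F (spaceU p m (L ∘ₗ LinearMap.proj i)) ∩ linearSet F (spaceW p F m)).ncard =
      Nat.card F ^ (m - 2) * {z : F | ∃ x : F, x ≠ 0 ∧ z = L x / x}.ncard +
        ∑ j ∈ Finset.range (m - 2), Nat.card F ^ j := by
  set Z := {z : F | ∃ x : F, x ≠ 0 ∧ z = L x / x}
  let D := LinearMap.ker (LinearMap.proj (R := F) (φ := fun _ : Fin (m - 1) => F) i)
  let T := D.map (vecLinear F m)
  have hD : Module.finrank F D = m - 2 := by rw [finrank_ker_proj, Nat.sub_sub]
  have hT : Module.finrank F T = m - 2 := by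
    rw [← hD]
    exact (D.equivMapOfInjective _ (vecLinear_injective hm)).symm.finrank_eq
  let e : Fin (m - 1) → F := Pi.single i 1
  have hei : e i = 1 := Pi.single_eq_same i 1
  have he (k : D) : (e + k.1) i = 1 := by
    have : k.1 i = 0 := k.2
    rw [Pi.add_apply, hei, this, add_zero]
  have hne (k : D) (z : F) : vec m (e + k.1) z 0 ≠ 0 := by
    rw [Ne, vec_eq_zero_iff hm]
    intro h
    have := he k
    rw [h.1] at this
    exact zero_ne_one this
  let Φ : D × Z → ℙ F (Fin (m + 1) → F) := fun w => Projectivization.mk F _ (hne w.1 w.2)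
  have hΦ : Function.Injective Φ := by
    rintro ⟨k, z⟩ ⟨k', z'⟩ h
    obtain ⟨c, hx, hz, -⟩ := (mk_vec_eq_mk_vec_iff hm ..).1 h
    have hc : c = 1 := by
      have := congrFun hx i
      rwa [Pi.smul_apply, he, he, smul_eq_mul, mul_one] at this
    subst hc
    rw [one_smul] at hx
    rw [one_mul] at hz
    exact Prod.ext (Subtype.ext (add_left_cancel hx).symm) (Subtype.ext hz.symm)
  have hunion : linearSet F (spaceU p m (L ∘ₗ LinearMap.proj i)) ∩ linearSet F (spaceW p F m) =
      Set.range Φ ∪ T.projectivization := by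
    rw [linearSet_inter_eq hm]
    ext Q
    constructor
    · rintro ⟨x, h, rfl⟩
      by_cases hx : x i = 0
      · right
        rw [SetLike.mem_coe, Submodule.mk_mem_projectivization_iff]
        refine ⟨x, hx, ?_⟩
        rw [LinearMap.comp_apply, LinearMap.proj_apply, hx, map_zero]
        rfl
      · left
        refine ⟨(⟨(x i)⁻¹ • x - e, ?_⟩, ⟨L (x i) / x i, x i, hx, rfl⟩), ?_⟩
        · change (x i)⁻¹ * x i - e i = 0
          rw [hei, inv_mul_cancel₀ hx, sub_self]
        · refine (mk_vec_eq_mk_vec_iff hm ..).2 ⟨(x i)⁻¹, ?_, ?_, mul_zero _⟩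
          · rw [add_sub_cancel]
          · exact (div_eq_inv_mul (L (x i)) (x i)).symm
    · rintro (⟨⟨k, z, t, ht, hz⟩, rfl⟩ | h)
      · have hx : vec m (t • (e + k.1)) ((L ∘ₗ LinearMap.proj i) (t • (e + k.1))) 0 ≠ 0 := by
          rw [Ne, vec_eq_zero_iff hm]
          intro h
          have := congrFun h.1 i
          rw [Pi.smul_apply, he, smul_eq_mul, mul_one] at this
          exact ht this
        refine ⟨t • (e + k.1), hx, ?_⟩
        refine (mk_vec_eq_mk_vec_iff hm ..).2 ⟨t⁻¹, ?_, ?_, mul_zero _⟩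
        · rw [inv_smul_smul₀ ht]
        · rw [LinearMap.comp_apply, LinearMap.proj_apply, Pi.smul_apply, he, smul_eq_mul, mul_one]
          exact ((div_eq_inv_mul _ _).symm.trans hz.symm)
      · induction Q using Projectivization.ind with
        | h v hv =>
          obtain ⟨x, hx, rfl⟩ := (Submodule.mk_mem_projectivization_iff T hv).1 h
          have hx' : (L ∘ₗ LinearMap.proj i) x = 0 := by
            have : x i = 0 := hx
            rw [LinearMap.comp_apply, LinearMap.proj_apply, this, map_zero]
          refine ⟨x, ?_, ?_⟩
          · rw [hx']
            exact hv
          · simp only [hx']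
            rfl
  have hdisj : Disjoint (Set.range Φ) (T.projectivization : Set (ℙ F (Fin (m + 1) → F))) := by
    rw [Set.disjoint_left]
    rintro _ ⟨⟨k, z⟩, rfl⟩ h
    obtain ⟨x, hx, h'⟩ := (Submodule.mk_mem_projectivization_iff T (hne k z)).1 h
    have h1 : x = e + k.1 := ((vec_inj hm).1 h').1
    have h2 : x i = 0 := hx
    rw [h1, he] at h2
    exact one_ne_zero h2
  have : Finite (ℙ F (Fin (m + 1) → F)) := Quotient.finite _
  rw [hunion, Set.ncard_union_eq hdisj, ncard_projectivization, hT, ← Set.image_univ,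
    Set.ncard_image_of_injective _ hΦ, Set.ncard_univ, Nat.card_prod,
    Module.natCard_eq_pow_finrank (K := F) (V := D), hD, Nat.card_coe_set_eq]

/-- The quotients are the `(p-1)`-th powers in the cyclic group `Fˣ`, whose order is divisible by `p
- 1`. -/
theorem isScattered_X_pow (p : ℕ) [Fact p.Prime] (F : Type*) [Field F] [Finite F]
    [Algebra (ZMod p) F] : IsScattered p (Polynomial.X ^ p : Polynomial F) := by
  have hp := (Fact.out : p.Prime).one_lt
  refine ⟨⟨2, fun i => if i = 1 then 1 else 0, by simp⟩, ?_⟩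
  have hset : {z : F | ∃ x : F, x ≠ 0 ∧ z = (Polynomial.X ^ p : Polynomial F).eval x / x} =
      Units.val '' ((powMonoidHom (p - 1) : Fˣ →* Fˣ).range : Set Fˣ) := by
    have hpow (u : Fˣ) : (u : F) ^ p / u = u ^ (p - 1) := by
      rw [div_eq_iff u.ne_zero, ← pow_succ, Nat.sub_add_cancel hp.le]
    ext z
    simp only [Polynomial.eval_pow, Polynomial.eval_X, Set.mem_ofPred_eq, Set.mem_image,
      SetLike.mem_coe, MonoidHom.mem_range, powMonoidHom_apply, exists_exists_eq_and]
    constructor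
    · rintro ⟨x, hx, rfl⟩
      exact ⟨Units.mk0 x hx, (hpow (Units.mk0 x hx)).symm⟩
    · rintro ⟨u, rfl⟩
      exact ⟨u, u.ne_zero, (hpow u).symm⟩
  have : Module.Finite (ZMod p) F := Module.Finite.of_finite
  have hcard : Nat.card F = p ^ Module.finrank (ZMod p) F := by
    rw [Module.natCard_eq_pow_finrank (K := ZMod p), Nat.card_zmod]
  have hdvd : p - 1 ∣ Nat.card F - 1 := by
    rw [hcard]
    exact Nat.sub_one_dvd_pow_sub_one ..
  have hncard : ((powMonoidHom (p - 1) : Fˣ →* Fˣ).range : Set Fˣ).ncard =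
      (Nat.card F - 1) / (p - 1) := by
    rw [← Nat.card_coe_set_eq, SetLike.coe_sort_coe, IsCyclic.card_powMonoidHom_range,
      Nat.card_units, Nat.gcd_eq_right hdvd]
  rw [hset, Set.ncard_image_of_injective _ Units.val_injective, hncard, Nat.cast_div hdvd,
    Nat.cast_sub Nat.card_pos, Nat.cast_sub hp.le, Nat.cast_one]
  rw [Ne, Nat.cast_eq_zero]
  omega

end Scattered

/-! ### The size of the multiset and its affine lines. -/

section Size

/-- Here `N` stands for `|L_U ∩ L_W|` and `D` for `|L_W \ L_U|`. Eliminating `D` leaves a linear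
equation in `N` with nonzero coefficient `-(p - 1)`. -/
theorem size_eq_iff {p q m N D : ℕ} (hp : 1 < p) (hq : 1 < q) (hm : 2 ≤ m)
    (h : N + D = ∑ i ∈ Finset.range m, q ^ i) :
    q ^ (m - 1) + (p - 1) * D = (p - 1) * (q ^ (m - 1) + q ^ (m - 2)) + q ^ (m - 2) ↔
      (N : ℚ) = (q : ℚ) ^ (m - 2) * (((q : ℚ) - 1) / ((p : ℚ) - 1)) +
        ((q : ℚ) ^ (m - 2) - 1) / ((q : ℚ) - 1) := by
  obtain ⟨k, rfl⟩ := Nat.exists_eq_add_of_le' hm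
  have hp' : (p : ℚ) - 1 ≠ 0 := sub_ne_zero.2 (by exact_mod_cast hp.ne')
  rw [← geom_sum_eq (by exact_mod_cast hq.ne'), ← Nat.cast_inj (R := ℚ)]
  rw [Finset.sum_range_succ, Finset.sum_range_succ, ← Nat.cast_inj (R := ℚ)] at h
  simp only [Nat.add_sub_cancel, show k + 2 - 1 = k + 1 by omega]
  push_cast [Nat.cast_sub hp.le] at h ⊢
  set S := ∑ i ∈ Finset.range k, (q : ℚ) ^ i
  have hD : (D : ℚ) = S + q ^ k + q ^ (k + 1) - N := by linear_combination h
  have hr := mul_div_cancel₀ ((q : ℚ) - 1) hp'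
  rw [hD]
  constructor <;> intro h
  · refine mul_left_cancel₀ hp' ?_
    linear_combination -h - (q : ℚ) ^ k * hr
  · linear_combination (1 - (p : ℚ)) * h - (q : ℚ) ^ k * hr

variable {p m : ℕ} [Fact p.Prime] {F : Type*} [Field F] [Finite F] [Algebra (ZMod p) F]

theorem multisetSize_eq_iff (hm : 2 ≤ m) (f : (Fin (m - 1) → F) →ₗ[ZMod p] F) :
    multisetSize
        (symmDiffMultiset p 1 (linearSet F (spaceU p m f)) (linearSet F (spaceW p F m))) =
        (p - 1) * (Nat.card F ^ (m - 1) + Nat.card F ^ (m - 2)) + Nat.card F ^ (m - 2) ↔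
      ((linearSet F (spaceU p m f) ∩ linearSet F (spaceW p F m)).ncard : ℚ) =
        (Nat.card F : ℚ) ^ (m - 2) * (((Nat.card F : ℚ) - 1) / ((p : ℚ) - 1)) +
          ((Nat.card F : ℚ) ^ (m - 2) - 1) / ((Nat.card F : ℚ) - 1) := by
  have : Finite (ℙ F (Fin (m + 1) → F)) := Quotient.finite _
  rw [multisetSize_symmDiffMultiset, ncard_linearSet_spaceU_diff (by omega)]
  refine size_eq_iff (Fact.out : p.Prime).one_lt Finite.one_lt_card hm ?_
  rw [← ncard_linearSet_spaceW (p := p) (by omega), Set.inter_comm,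
    Set.ncard_inter_add_ncard_sdiff_eq_ncard]

theorem support_symmDiffMultiset_subset {X : Type*} (p t : ℕ) (A B : Set X) :
    Function.support (symmDiffMultiset p t A B) ⊆ symmDiff A B := by
  intro Q hQ
  by_contra h
  rw [Set.mem_symmDiff, not_or] at h
  refine hQ ?_
  rw [← Set.mem_sdiff, ← Set.mem_sdiff] at h
  rw [symmDiffMultiset, if_neg h.1, if_neg h.2]

theorem isAffineZeroMod_comp_affineChart (hm : 1 ≤ m) (f : (Fin (m - 1) → F) →ₗ[ZMod p] F)
    (g : (Fin (m + 1) → F) ≃ₗ[F] (Fin (m + 1) → F))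
    (hg : symmDiff (linearSet F (spaceU p m f)) (linearSet F (spaceW p F m)) ⊆
      Set.range (affineChart g)) :
    IsAffineZeroMod p (symmDiffMultiset p 1 (linearSet F (spaceU p m f))
      (linearSet F (spaceW p F m)) ∘ affineChart g) := by
  intro l hl
  obtain ⟨T, hT, h⟩ := exists_multiplicitySum_comp_affineChart_eq g
    ((support_symmDiffMultiset_subset ..).trans hg) l hl
  rw [h]
  have hq : 0 < Nat.card F := Nat.card_pos
  -- The factor `p`, from the coordinate `y ∈ 𝔽_p`, is what makes the inequality strict.
  have hlt : Nat.card (Fin (m + 1) → F) <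
      Nat.card F ^ (m - 1) * p * Nat.card (T.restrictScalars (ZMod p)) := by
    calc Nat.card (Fin (m + 1) → F) = Nat.card F ^ (m - 1) * Nat.card F ^ 2 := by
          rw [Nat.card_fun, Nat.card_fin, ← pow_add]
          congr 1
          omega
      _ < Nat.card F ^ (m - 1) * Nat.card F ^ 2 * p :=
          lt_mul_of_one_lt_right (by positivity) (Fact.out : p.Prime).one_lt
      _ = Nat.card F ^ (m - 1) * p * Nat.card F ^ 2 := by ring
      _ ≤ _ := Nat.mul_le_mul_left _ hT
  refine dvd_multiplicitySum_symmDiffMultiset ?_ ?_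
  · exact inf_ne_bot_of_card_lt _ _ (by rwa [card_spaceU hm])
  · exact inf_ne_bot_of_card_lt _ _ (by rwa [card_spaceW hm])

end Size

end AffineMultisets

theorem mainTheorem8 (p h m q : ℕ) [Fact p.Prime] (hh : 1 ≤ h) (hm : 2 ≤ m) (hq : q = p ^ h)
    (F : Type*) [Field F] [Finite F] [Algebra (ZMod p) F] (hF : Nat.card F = q) :
    -- the construction for an arbitrary 𝔽_p-linear `f`
    (∀ f : (Fin (m - 1) → F) →ₗ[ZMod p] F,
      (symmDiff (linearSet F (spaceU p m f)) (linearSet F (spaceW p F m))).Nonempty ∧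
      (∃ H : Submodule F (Fin (m + 1) → F), Module.finrank F H = m ∧
        Disjoint (H.projectivization : Set (ℙ F (Fin (m + 1) → F)))
          (symmDiff (linearSet F (spaceU p m f)) (linearSet F (spaceW p F m)))) ∧
      (multisetSize
          (symmDiffMultiset p 1 (linearSet F (spaceU p m f)) (linearSet F (spaceW p F m))) =
          (p - 1) * (q ^ (m - 1) + q ^ (m - 2)) + q ^ (m - 2) ↔
        ((linearSet F (spaceU p m f) ∩ linearSet F (spaceW p F m)).ncard : ℚ) =
          (q : ℚ) ^ (m - 2) * (((q : ℚ) - 1) / ((p : ℚ) - 1)) +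
            ((q : ℚ) ^ (m - 2) - 1) / ((q : ℚ) - 1))) ∧
    -- scattered polynomials yield affine (0 mod p)-multisets attaining the bound
    (∀ (P : Polynomial F) (hP : IsScattered p P) (f : (Fin (m - 1) → F) →ₗ[ZMod p] F),
      f = linearizedMap p P hP.1 ∘ₗ LinearMap.proj (⟨0, by omega⟩ : Fin (m - 1)) →
      ((linearSet F (spaceU p m f) ∩ linearSet F (spaceW p F m)).ncard : ℚ) =
          (q : ℚ) ^ (m - 2) * (((q : ℚ) - 1) / ((p : ℚ) - 1)) +
            ((q : ℚ) ^ (m - 2) - 1) / ((q : ℚ) - 1) ∧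
      ∃ g : (Fin (m + 1) → F) ≃ₗ[F] (Fin (m + 1) → F),
        symmDiff (linearSet F (spaceU p m f)) (linearSet F (spaceW p F m)) ⊆
          Set.range (affineChart g) ∧
        ∃ ν : (Fin m → F) → ℕ,
          (∀ x, ν x = symmDiffMultiset p 1 (linearSet F (spaceU p m f))
            (linearSet F (spaceW p F m)) (affineChart g x)) ∧
          IsAffineZeroMod p ν ∧ (∃ x, ν x = 1) ∧
          multisetSize ν = (p - 1) * (q ^ (m - 1) + q ^ (m - 2)) + q ^ (m - 2)) ∧
    -- scattered polynomials exist
    (∃ P : Polynomial F, IsScattered p P) := by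
  subst hF
  have hm1 : 1 ≤ m := by omega
  refine ⟨fun f => ⟨?_, ?_, multisetSize_eq_iff hm f⟩, fun P hP f hf => ?_, _,
    isScattered_X_pow p F⟩
  · refine ⟨Projectivization.mk F (vec m 0 (f 0) 1) (vec_one_ne_zero hm1 _ _), Or.inl ?_⟩
    exact (linearSet_spaceU_diff hm1).ge ⟨0, rfl⟩
  · obtain ⟨φ, hφ, h⟩ := exists_functional_ne_zero hm1 f
    refine ⟨LinearMap.ker φ, ?_, Set.disjoint_left.2 fun Q hQ hQ' => ?_⟩
    · have := Module.Dual.finrank_ker_add_one_of_ne_zero (f := φ) hφ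
      rw [Module.finrank_fin_fun] at this
      omega
    · induction Q using Projectivization.ind with
      | h v hv => exact h v hv hQ' hQ
  · have hN : ((linearSet F (spaceU p m f) ∩ linearSet F (spaceW p F m)).ncard : ℚ) =
        (Nat.card F : ℚ) ^ (m - 2) * (((Nat.card F : ℚ) - 1) / ((p : ℚ) - 1)) +
          ((Nat.card F : ℚ) ^ (m - 2) - 1) / ((Nat.card F : ℚ) - 1) := by
      have hF : (Nat.card F : ℚ) ≠ 1 := by exact_mod_cast Finite.one_lt_card.ne'
      have hZ : ({z : F | ∃ x : F, x ≠ 0 ∧ z = linearizedMap p P hP.1 x / x}.ncard : ℚ) =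
          ((Nat.card F : ℚ) - 1) / ((p : ℚ) - 1) := hP.2
      rw [hf, ncard_linearSet_inter_of_proj hm1, ← geom_sum_eq hF, Nat.cast_add, Nat.cast_mul, hZ]
      push_cast
      rfl
    refine ⟨hN, ?_⟩
    obtain ⟨φ, hφ, h⟩ := exists_functional_ne_zero hm1 f
    obtain ⟨g, hg⟩ := exists_equiv_apply_eq_last φ hφ
    have hrange : symmDiff (linearSet F (spaceU p m f)) (linearSet F (spaceW p F m)) ⊆
        Set.range (affineChart g) := by
      intro Q hQ
      induction Q using Projectivization.ind with
      | h v hv =>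
        refine mk_mem_range_affineChart g hv ?_
        rw [← hg (g.symm v), g.apply_symm_apply]
        exact h v hv hQ
    refine ⟨g, hrange, _, fun x => rfl, isAffineZeroMod_comp_affineChart hm1 f g hrange, ?_, ?_⟩
    · have hmem : Projectivization.mk F (vec m 0 (f 0) 1) (vec_one_ne_zero hm1 _ _) ∈
          linearSet F (spaceU p m f) \ linearSet F (spaceW p F m) :=
        (linearSet_spaceU_diff hm1).ge ⟨0, rfl⟩
      obtain ⟨x, hx⟩ := hrange (Or.inl hmem)
      refine ⟨x, ?_⟩
      rw [hx, symmDiffMultiset, if_pos hmem]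
    · refine (multisetSize_comp_affineChart g
        ((support_symmDiffMultiset_subset ..).trans hrange)).trans ?_
      exact (multisetSize_eq_iff hm f).2 hN
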